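/- Let $\Sigma=\{a,b\}$ be a two-letter alphabet and let $w\in\Sigma^*$ be a Sturmian palindrome, that is, $w$ equals its reversal and $w$ is balanced: for all factors $u,v$ of $w$ with $|u|=|v|$ and every letter $c\in\Sigma$ one has $\bigl||u|_c-|v|_c\bigr|\le 1$, where $|u|_c$ is the number of occurrences of $c$ in $u$. A word $u$ is a left special (resp. right special) factor of $w$ if there are distinct letters $x,y$ such that $xu$ and $yu$ (resp. $ux$ and $uy$) are both factors of $w$. If both letters occur in $w$, then $w$ has exactly one left special factor of maximal length. (Otherwise $w$ is a power of a single letter and has no special factors.) A word is a left special factor of $w$ of maximal length if and only if it is a right special factor of $w$ of maximal length, and every such word is central. Here a word $z=z_1\cdots z_n$ is central if it has two coprime periods $p,q$ with $n=p+q-2$, where a period of $z$ is an integer $p\ge 1$ (possibly $p>n$) such that $z_i=z_{i+p}$ whenever $1\le i\le n-p$. -/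

import Mathlib

/-! Finite words over an alphabet `A` are lists `List A`; `u <:+: w` says that `u` is a factor
(contiguous subword) of `w`, and `w.count c` is the number of occurrences of the letter `c`. -/

namespace Word

variable {A : Type*}

/-- A word over a two-letter alphabet is a (finite) Sturmian word if it is balanced: any two
factors of equal length contain the same number of `c`'s up to one, for every letter `c`.
The two-letter alphabet is a hypothesis of the theorem. -/
def IsSturmian [DecidableEq A] (w : List A) : Prop :=
  ∀ u v : List A, u <:+: w → v <:+: w → u.length = v.length →
    ∀ c : A, |(u.count c : ℤ) - (v.count c : ℤ)| ≤ 1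

/-- `w` equals its reversal. -/
def IsPalindrome (w : List A) : Prop := w.reverse = w

/-- `u` is a left special factor of `w`: it is preceded in `w` by two different letters. -/
def IsLeftSpecial (w u : List A) : Prop :=
  ∃ a b : A, a ≠ b ∧ (a :: u) <:+: w ∧ (b :: u) <:+: w

/-- `u` is a right special factor of `w`: it is followed in `w` by two different letters. -/
def IsRightSpecial (w u : List A) : Prop :=
  ∃ a b : A, a ≠ b ∧ (u ++ [a]) <:+: w ∧ (u ++ [b]) <:+: w

/-- `u` is a left special factor of `w` of maximal length. -/
def IsLongestLeftSpecial (w u : List A) : Prop :=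
  IsLeftSpecial w u ∧ ∀ v : List A, IsLeftSpecial w v → v.length ≤ u.length

/-- `u` is a right special factor of `w` of maximal length. -/
def IsLongestRightSpecial (w u : List A) : Prop :=
  IsRightSpecial w u ∧ ∀ v : List A, IsRightSpecial w v → v.length ≤ u.length

/-- `p` is a period of `w`: `p` is positive and letters of `w` at distance `p` agree
(`List.hasPeriod_iff_getElem?`). Periods
larger than the length of `w` are allowed (as usual for central words, so that powers of a single
letter and the empty word are central). -/
def IsPeriod (w : List A) (p : ℕ) : Prop :=
  0 < p ∧ w.HasPeriod p

/-- A central word: it has two coprime periods `p`, `q`, and length `p + q - 2`. -/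
def IsCentral (w : List A) : Prop :=
  ∃ p q : ℕ, IsPeriod w p ∧ IsPeriod w q ∧ Nat.Coprime p q ∧ w.length + 2 = p + q

end Word

/-! Two distinct left special factors of equal length would share a prefix `p` and yield factors
`xpx`, `ypy` with `x ≠ y`, against balance. So each length has at most one (`eq_of_isLeftSpecial`),
which gives uniqueness.

Let `u` be a longest one. It is also right special (`IsLongestLeftSpecial.isRightSpecial`). Reversal
preserves `w` and swaps left and right special, so `u.reverse` is left special too, hence `u` is a
palindrome and the two notions of longest agree.

For centrality put `n = |u| + 2` and let `g s` count a letter `b` in the prefix of `u` of length `s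
- 1`. Balance against `au` and `bu` makes `g` additive up to a carry; the palindrome property gives
its symmetry. Hence `g s = ⌊s * h / n⌋` with `h = |u|_b + 1` coprime to `n`. Translating by the
inverse `p` of `h` modulo `n`, or by `n - p`, gives a constant carry, so both are periods of `u`. -/

/-! ### Quasi-additive integer sequences -/

/-- An integer sequence on `[1, n)` that is additive up to a carry in `{0, 1}`, and satisfies the
symmetry `g s + g (n - s) = h - 1`, is `s ↦ ⌊s * h / n⌋`, with no `s * h` divisible by `n`. -/
theorem quasiadditive_bounds {n : ℕ} {h : ℤ} {g : ℕ → ℤ} (g_zero : g 0 = 0)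
    (g_add : ∀ s t, 1 ≤ s → 1 ≤ t → s + t < n → g s + g t ≤ g (s + t) ∧ g (s + t) ≤ g s + g t + 1)
    (g_compl : ∀ s t, 1 ≤ s → 1 ≤ t → s + t = n → g s + g t = h - 1)
    {s : ℕ} (hs : 1 ≤ s) (hsn : s < n) : n * g s < s * h ∧ s * h < n * g s + n := by
  -- Add `s` repeatedly modulo `n`: each addition costs at most one carry. After `n` terms the
  -- remainder is `0` and `c = s`.
  have key : ∀ s : ℕ, 1 ≤ s → s < n → ∀ k : ℕ, ∃ c m : ℕ, m < n ∧ (k + 1) * s = c * n + m ∧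
      (k + 1) * g s ≤ c * h + g m ∧ c * h + g m ≤ (k + 1) * g s + k := by
    intro s hs hsn k
    induction k with
    | zero => exact ⟨0, s, hsn, by simp, by simp, by simp⟩
    | succ k ih =>
      obtain ⟨c, m, hm, h1, h2, h3⟩ := ih
      have e : (k + 1 + 1) * s = c * n + m + s := by rw [← h1]; ring
      rcases Nat.eq_zero_or_pos m with rfl | hm0
      · refine ⟨c, s, hsn, by simpa using e, ?_, ?_⟩ <;> push_cast <;> linarith
      rcases lt_trichotomy (m + s) n with hlt | heq | hgt
      · have := g_add m s hm0 hs hlt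
        refine ⟨c, m + s, hlt, by rw [e]; ring, ?_, ?_⟩ <;> push_cast <;> linarith
      · have := g_compl m s hm0 hs heq
        refine ⟨c + 1, 0, by omega, by rw [e, add_assoc, heq]; ring, ?_, ?_⟩ <;>
          push_cast <;> linarith
      -- On wrap-around, the complements `n - m` and `n - s` have sum below `n`, so `g_add` applies
      -- to them and symmetry transfers the bound back.
      · obtain ⟨r, hr⟩ : ∃ r, m + s = n + r := ⟨m + s - n, by omega⟩
        have h4 := g_add (n - m) (n - s) (by omega) (by omega) (by omega)
        have h5 := g_compl m (n - m) hm0 (by omega) (by omega)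
        have h6 := g_compl s (n - s) hs (by omega) (by omega)
        have h7 := g_compl r (n - m + (n - s)) (by omega) (by omega) (by omega)
        refine ⟨c + 1, r, by omega, by rw [e, add_assoc, hr]; ring, ?_, ?_⟩ <;>
          push_cast <;> linarith
  have bounds : ∀ s : ℕ, 1 ≤ s → s < n → n * g s ≤ s * h ∧ s * h < n * g s + n := by
    intro s hs hsn
    obtain ⟨c, m, hm, h1, h2, h3⟩ := key s hs hsn (n - 1)
    have hn : n - 1 + 1 = n := by omega
    have hn' : ((n - 1 : ℕ) : ℤ) + 1 = n := by exact_mod_cast hn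
    rw [hn] at h1
    rw [hn'] at h2 h3
    have hm0 : m = 0 := by
      have : n ∣ m := (Nat.dvd_add_right (Dvd.intro_left c rfl)).1 (h1 ▸ Dvd.intro s rfl)
      exact Nat.eq_zero_of_dvd_of_lt this hm
    subst hm0
    have hc : s = c := by
      apply Nat.eq_of_mul_eq_mul_left (show 0 < n by omega)
      rw [h1]; ring
    subst hc
    rw [g_zero] at h2 h3
    constructor <;> linarith
  -- Equality at `s` would contradict the strict upper bound at `n - s`.
  refine ⟨lt_of_le_of_ne (bounds s hs hsn).1 fun heq => ?_, (bounds s hs hsn).2⟩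
  have h1 := (bounds (n - s) (by omega) (by omega)).2
  have h2 := g_compl s (n - s) hs (by omega) (by omega)
  have h3 : ((n - s : ℕ) : ℤ) = n - s := by push_cast [hsn.le]; rfl
  have h4 : g (n - s) = h - 1 - g s := by linarith
  rw [h3, h4] at h1
  linarith

/-- Under the assumptions of `quasiadditive_bounds` there is `p` coprime to `n` such that
translation by `p` never produces a carry and translation by `n - p` always produces one. -/
theorem exists_coprime_carry {n : ℕ} (hn : 2 ≤ n) {h : ℤ} {g : ℕ → ℤ} (g_zero : g 0 = 0)
    (g_add : ∀ s t, 1 ≤ s → 1 ≤ t → s + t < n → g s + g t ≤ g (s + t) ∧ g (s + t) ≤ g s + g t + 1)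
    (g_compl : ∀ s t, 1 ≤ s → 1 ≤ t → s + t = n → g s + g t = h - 1) :
    ∃ p q, 1 ≤ p ∧ 1 ≤ q ∧ p + q = n ∧ Nat.Coprime p q ∧
      (∀ s, 1 ≤ s → s + p < n → g (s + p) = g s + g p) ∧
      (∀ s, 1 ≤ s → s + q < n → g (s + q) = g s + g q + 1) := by
  have bounds := fun s => quasiadditive_bounds g_zero g_add g_compl (s := s)
  have hcop : IsCoprime h n := by
    rw [Int.isCoprime_iff_gcd_eq_one]
    by_contra hd
    -- For a common divisor `d > 1`, the index `s = n / d` makes `s * h` divisible by `n`, which the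
    -- strict bounds exclude.
    obtain ⟨s, hs⟩ : Int.gcd h n ∣ n := by exact_mod_cast Int.gcd_dvd_right h n
    obtain ⟨c, hc⟩ := Int.gcd_dvd_left h n
    generalize Int.gcd h n = d at *
    have hd0 : d ≠ 0 := by rintro rfl; omega
    have hs0 : 1 ≤ s := by
      rcases Nat.eq_zero_or_pos s with rfl | h0
      · omega
      · exact h0
    have hsn : s < n := by nlinarith [show 2 ≤ d by omega]
    have hb := bounds s hs0 hsn
    have e : (s : ℤ) * h = n * c := by rw [hc, hs]; push_cast; ring
    rw [e] at hb
    have hn0 : (0 : ℤ) < n := by omega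
    have h1 : g s < c := lt_of_mul_lt_mul_left hb.1 hn0.le
    have h2 : c < g s + 1 := lt_of_mul_lt_mul_left (by linarith) hn0.le
    omega
  obtain ⟨x, y, hxy⟩ := hcop
  have hn0 : (0 : ℤ) < n := by omega
  obtain ⟨p, hp⟩ := Int.eq_ofNat_of_zero_le (Int.emod_nonneg x hn0.ne')
  have hdiv := Int.emod_add_mul_ediv x n
  rw [hp] at hdiv
  have hpn : p < n := by
    have := Int.emod_lt_of_pos x hn0
    omega
  -- `p` inverts `h` modulo `n`: adding `p` raises the residue of `s * h` by just `1`, too little to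
  -- cause a carry.
  have hinv : (p : ℤ) * h = n * (-y - x / n * h) + 1 := by
    have : (p : ℤ) = x - n * (x / n) := by linarith
    rw [this]
    linear_combination hxy
  have hp1 : 1 ≤ p := by
    rcases Nat.eq_zero_or_pos p with rfl | h0
    · have : (n : ℤ) ∣ 1 := ⟨-(-y - x / n * h), by push_cast at hinv; linarith⟩
      have := Int.le_of_dvd one_pos this
      omega
    · exact h0
  have hgp : g p = -y - x / n * h := by
    have hb := bounds p hp1 hpn
    rw [hinv] at hb
    generalize -y - x / n * h = c at *
    have h1 : g p < c + 1 := lt_of_mul_lt_mul_left (a := (n : ℤ)) (by linarith) hn0.le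
    have h2 : c < g p + 1 := lt_of_mul_lt_mul_left (a := (n : ℤ)) (by linarith) hn0.le
    omega
  rw [← hgp] at hinv
  refine ⟨p, n - p, hp1, by omega, by omega, ?_, ?_, ?_⟩
  · have : Nat.Coprime p n := by
      rw [← Nat.isCoprime_iff_coprime]
      exact ⟨h, -g p, by linarith⟩
    rwa [Nat.coprime_sub_self_right hpn.le]
  · intro s hs hsp
    have h1 := bounds s hs (by omega)
    have h2 := bounds (s + p) (by omega) hsp
    have h3 := g_add s p hs hp1 hsp
    rcases h3.1.eq_or_lt with h4 | h4
    · exact h4.symm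
    · have h5 : g (s + p) = g s + g p + 1 := by omega
      rw [h5] at h2
      push_cast at h2
      linarith
  · intro s hs hsp
    have h1 := bounds s hs (by omega)
    have h2 := bounds (s + (n - p)) (by omega) hsp
    have h3 := g_add s (n - p) hs (by omega) hsp
    have h4 := g_compl p (n - p) hp1 (by omega) (by omega)
    rcases h3.2.eq_or_lt with h5 | h5
    · exact h5
    · have h6 : g (s + (n - p)) = g s + g (n - p) := by omega
      have h7 : g (n - p) = h - 1 - g p := by linarith
      have h8 : ((n - p : ℕ) : ℤ) = n - p := by push_cast [hpn.le]; rfl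
      rw [h6, h7] at h2
      push_cast [h8] at h2
      linarith

/-! ### Palindromes and special factors -/

namespace Word
variable {A : Type*}

theorem eq_or_eq_of_card_eq_two (hA : Nat.card A = 2) {x y : A} (hxy : x ≠ y) (z : A) :
    z = x ∨ z = y := by
  obtain ⟨a, b, -, hu⟩ := Nat.card_eq_two_iff.1 hA
  have h : ∀ t : A, t = a ∨ t = b := fun t => by
    have : t ∈ ({a, b} : Set A) := hu ▸ Set.mem_univ t
    simpa using this
  rcases h x with rfl | rfl <;> rcases h y with rfl | rfl <;> rcases h z with rfl | rfl <;> simp_all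

theorem IsPalindrome.reverse_infix_iff {w : List A} (hP : IsPalindrome w) {u : List A} :
    u.reverse <:+: w ↔ u <:+: w := by
  conv_lhs => rw [← hP]
  exact List.reverse_infix

theorem IsPalindrome.isRightSpecial_reverse_iff {w : List A} (hP : IsPalindrome w) {u : List A} :
    IsRightSpecial w u.reverse ↔ IsLeftSpecial w u := by
  simp only [IsRightSpecial, IsLeftSpecial, ← List.reverse_cons, hP.reverse_infix_iff]

theorem IsPalindrome.isLeftSpecial_reverse_iff {w : List A} (hP : IsPalindrome w) {u : List A} :
    IsLeftSpecial w u.reverse ↔ IsRightSpecial w u := by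
  rw [← hP.isRightSpecial_reverse_iff, List.reverse_reverse]

theorem IsPalindrome.getElem?_eq {w : List A} (hP : IsPalindrome w) {i j : ℕ}
    (hij : i + j + 1 = w.length) : w[i]? = w[j]? := by
  conv_lhs => rw [← hP]
  exact List.getElem?_reverse' hij

theorem take_drop_infix (w : List A) (i n : ℕ) : (w.drop i).take n <:+: w :=
  (List.take_prefix n _).isInfix.trans (List.drop_suffix i w).isInfix

theorem exists_append_cons_of_ne {u v : List A} (hl : u.length = v.length) (hne : u ≠ v) :
    ∃ p x y s t, x ≠ y ∧ u = p ++ x :: s ∧ v = p ++ y :: t := by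
  induction u generalizing v with
  | nil => cases v <;> simp_all
  | cons a u ih =>
    cases v with
    | nil => simp at hl
    | cons b v =>
      by_cases hab : a = b
      · subst hab
        obtain ⟨p, x, y, s, t, h, rfl, rfl⟩ := ih (by simpa using hl) (by simpa using hne)
        exact ⟨a :: p, x, y, s, t, h, rfl, rfl⟩
      · exact ⟨[], a, b, u, v, hab, rfl, rfl⟩

/-! ### Special factors and factor complexity of balanced words -/

section
variable [DecidableEq A]

theorem IsSturmian.eq_of_isLeftSpecial (hA : Nat.card A = 2) {w : List A} (hS : IsSturmian w)
    {u v : List A} (hu : IsLeftSpecial w u) (hv : IsLeftSpecial w v)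
    (hl : u.length = v.length) : u = v := by
  by_contra hne
  have ext : ∀ (c : A) (z : List A), IsLeftSpecial w z → (c :: z) <:+: w := by
    rintro c z ⟨a, b, hab, ha, hb⟩
    rcases eq_or_eq_of_card_eq_two hA hab c with rfl | rfl <;> assumption
  obtain ⟨p, x, y, s, t, hxy, rfl, rfl⟩ := exists_append_cons_of_ne hl hne
  have h1 : (x :: (p ++ [x])) <:+: w :=
    (List.IsInfix.trans ⟨[], s, by simp⟩ (ext x _ hu))
  have h2 : (y :: (p ++ [y])) <:+: w :=
    (List.IsInfix.trans ⟨[], t, by simp⟩ (ext y _ hv))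
  have h3 := hS _ _ h1 h2 (by simp) x
  simp [List.count_append, hxy.symm] at h3
  grind

/-- The set of factors of `w` of length `n`. -/
def factors (w : List A) (n : ℕ) : Finset (List A) :=
  (Finset.range (w.length + 1 - n)).image fun i => (w.drop i).take n

theorem mem_factors {w u : List A} {n : ℕ} : u ∈ factors w n ↔ u <:+: w ∧ u.length = n := by
  simp only [factors, Finset.mem_image, Finset.mem_range]
  constructor
  · rintro ⟨i, hi, rfl⟩
    exact ⟨take_drop_infix w i n, by simp; omega⟩
  · rintro ⟨⟨s, t, rfl⟩, rfl⟩
    exact ⟨s.length, by simp; omega, by simp⟩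

/-- Deleting the first letter merges two factors only over a left special factor; there is at most
one of each length, and it merges just two. -/
theorem IsSturmian.card_factors_le (hA : Nat.card A = 2) {w : List A} (hS : IsSturmian w)
    (n : ℕ) : (factors w n).card ≤ n + 1 := by
  induction n with
  | zero =>
    refine Finset.card_le_one.2 fun u hu v hv => ?_
    rw [mem_factors, List.length_eq_zero_iff] at hu hv
    rw [hu.2, hv.2]
  | succ n ih =>
    have hmaps : ∀ z ∈ factors w (n + 1), z.tail ∈ factors w n := by
      intro z hz
      rw [mem_factors] at hz ⊢
      exact ⟨(List.tail_suffix z).isInfix.trans hz.1, by simp [hz.2]⟩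
    have hcons : ∀ z ∈ factors w (n + 1), ∃ c u, z = c :: u ∧ (c :: u) <:+: w ∧ u.length = n := by
      intro z hz
      rw [mem_factors] at hz
      cases z with
      | nil => simp at hz
      | cons c u => exact ⟨c, u, rfl, hz.1, by simpa using hz.2⟩
    by_cases hinj : Set.InjOn List.tail (factors w (n + 1) : Set (List A))
    · have := Finset.card_le_card_of_injOn List.tail hmaps hinj
      omega
    · simp only [Set.InjOn, not_forall] at hinj
      obtain ⟨z₁, h₁, z₂, h₂, htail, hne⟩ := hinj
      have h₁' := h₁
      obtain ⟨x, u, rfl, hx, hu⟩ := hcons z₁ h₁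
      obtain ⟨y, u', rfl, hy, -⟩ := hcons z₂ h₂
      simp only [List.tail_cons] at htail
      subst htail
      have hxy : x ≠ y := fun h => hne (by rw [h])
      have hsp : IsLeftSpecial w u := ⟨x, y, hxy, hx, hy⟩
      have hcard := Finset.card_le_card_of_injOn (s := (factors w (n + 1)).erase (x :: u))
        (t := factors w n) List.tail (fun z hz => hmaps z (Finset.mem_of_mem_erase hz)) (by
          intro z hz z' hz' htail
          simp only [Finset.coe_erase, Set.mem_sdiff, Finset.mem_coe, Set.mem_singleton_iff]
            at hz hz'
          obtain ⟨c, v, rfl, hc, hv⟩ := hcons z hz.1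
          obtain ⟨c', v', rfl, hc', -⟩ := hcons z' hz'.1
          simp only [List.tail_cons] at htail
          subst htail
          by_contra hcc
          have hcc' : c ≠ c' := fun h => hcc (by rw [h])
          have : v = u := hS.eq_of_isLeftSpecial hA ⟨c, c', hcc', hc, hc'⟩ hsp (by omega)
          subst this
          rcases eq_or_eq_of_card_eq_two hA hcc' x with rfl | rfl
          · exact hz.2 rfl
          · exact hz'.2 rfl)
      rw [Finset.card_erase_of_mem h₁'] at hcard
      omega

theorem IsSturmian.exists_repeated_factor (hA : Nat.card A = 2) {w : List A}
    (hS : IsSturmian w) {n : ℕ} (hn : 2 * n < w.length) :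
    ∃ i j, i < j ∧ j + n ≤ w.length ∧ (w.drop i).take n = (w.drop j).take n := by
  have hlt : (factors w n).card < (Finset.range (w.length + 1 - n)).card := by
    have := hS.card_factors_le hA n
    rw [Finset.card_range]
    omega
  obtain ⟨i, hi, j, hj, hij, h⟩ := Finset.exists_ne_map_eq_of_card_lt_of_maps_to hlt
    (f := fun i => (w.drop i).take n) (fun i hi => Finset.mem_image_of_mem _ hi)
  rw [Finset.mem_range] at hi hj
  rcases lt_or_gt_of_ne hij with h' | h'
  · exact ⟨i, j, h', by omega, h⟩
  · exact ⟨j, i, h', by omega, h.symm⟩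
end

/-! ### Occurrences, repetitions and periods -/

theorem take_drop_eq_iff {w : List A} {i j n : ℕ} :
    (w.drop i).take n = (w.drop j).take n ↔ ∀ k < n, w[i + k]? = w[j + k]? := by
  constructor
  · intro h k hk
    have := congrArg (fun l => l[k]?) h
    simpa [List.getElem?_take, hk] using this
  · intro h
    ext1 k
    by_cases hk : k < n
    · simp [hk, h k hk]
    · simp [hk]

theorem isLeftSpecial_of_getElem? {w : List A} {i j n : ℕ} (hi : i + 1 + n ≤ w.length)
    (hj : j + 1 + n ≤ w.length) (h : ∀ k < n, w[i + 1 + k]? = w[j + 1 + k]?)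
    (hne : w[i]? ≠ w[j]?) : IsLeftSpecial w ((w.drop (i + 1)).take n) := by
  have cons : ∀ i (hi : i < w.length), w[i] :: (w.drop (i + 1)).take n <:+: w := by
    intro i hi
    rw [← List.take_succ_cons, ← List.drop_eq_getElem_cons]
    exact take_drop_infix w i _
  refine ⟨w[i], w[j], fun h => hne ?_, cons i _, ?_⟩
  · simp [show i < w.length by omega, show j < w.length by omega, h]
  · rw [take_drop_eq_iff.2 h]
    exact cons j _

theorem isRightSpecial_of_getElem? {w : List A} {i j n : ℕ} (hi : i + n < w.length)
    (hj : j + n < w.length) (h : ∀ k < n, w[i + k]? = w[j + k]?)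
    (hne : w[i + n]? ≠ w[j + n]?) : IsRightSpecial w ((w.drop i).take n) := by
  have concat : ∀ i (hi : i + n < w.length), (w.drop i).take n ++ [w[i + n]] <:+: w := by
    intro i hi
    have : (w.drop i).take n ++ [w[i + n]] = (w.drop i).take (n + 1) := by
      rw [List.take_succ_eq_append_getElem (by simp; omega)]
      simp
    rw [this]
    exact take_drop_infix w i _
  refine ⟨w[i + n], w[j + n], fun h => hne ?_, concat i _, ?_⟩
  · simp [hi, hj, h]
  · rw [take_drop_eq_iff.2 h]
    exact concat j _

/-- A word without special factors of length `n` in which some factor of length `n` occurs at two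
positions of distance `d` satisfies `w[k] = w[k + d]` throughout. -/
theorem getElem?_add_of_repeated {w : List A} {n : ℕ} (hn : 0 < n)
    (hL : ∀ v, IsLeftSpecial w v → v.length ≠ n) (hR : ∀ v, IsRightSpecial w v → v.length ≠ n)
    {i d : ℕ} (hi : i + d + n ≤ w.length) (h : ∀ k < n, w[i + k]? = w[i + d + k]?) :
    ∀ k, k + d < w.length → w[k]? = w[k + d]? := by
  -- A first mismatch while sliding the two windows left would create a left special factor of
  -- length `n`; sliding right, a right special one.
  have left : ∀ j, j ≤ i → ∀ k < n, w[j + k]? = w[j + d + k]? := by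
    intro j hj
    induction hj using Nat.decreasingInduction with
    | self => exact h
    | of_succ j hj ih =>
      have h0 : w[j]? = w[j + d]? := by
        by_contra hne
        refine hL _ (isLeftSpecial_of_getElem? (n := n) (i := j) (j := j + d) (by omega) (by omega)
          ?_ hne) (by simp; omega)
        intro k hk
        rw [ih k hk]; congr 1; omega
      intro k hk
      cases k with
      | zero => exact h0
      | succ k =>
        have := ih k (by omega)
        rwa [show j + 1 + k = j + (k + 1) by omega,
          show j + 1 + d + k = j + d + (k + 1) by omega] at this
  have right : ∀ j, j + d + n ≤ w.length → ∀ k < n, w[j + k]? = w[j + d + k]? := by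
    intro j hj
    induction j with
    | zero => exact left 0 (by omega)
    | succ j ih =>
      have ih := ih (by omega)
      have h0 : w[j + n]? = w[j + d + n]? := by
        by_contra hne
        exact hR _ (isRightSpecial_of_getElem? (n := n) (i := j) (j := j + d) (by omega) (by omega)
          ih hne) (by simp; omega)
      intro k hk
      have : w[j + (k + 1)]? = w[j + d + (k + 1)]? := by
        rcases Nat.lt_or_ge (k + 1) n with h' | h'
        · exact ih _ h'
        · rwa [show k + 1 = n by omega]
      rwa [show j + 1 + k = j + (k + 1) by omega,
        show j + 1 + d + k = j + d + (k + 1) by omega]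
  intro k hk
  rcases Nat.le_total (k + d + n) w.length with h' | h'
  · simpa using right k h' 0 hn
  · have := right (w.length - d - n) (by omega) (k - (w.length - d - n)) (by omega)
    rwa [show w.length - d - n + (k - (w.length - d - n)) = k by omega,
      show w.length - d - n + d + (k - (w.length - d - n)) = k + d by omega] at this
-- The longest left special factor is a palindrome
-- If both occurrences were followed by the same letter, appending it to `u` would give a longer
-- left special factor.
theorem IsLongestLeftSpecial.isRightSpecial_of_getElem? {w u : List A}
    (hu : IsLongestLeftSpecial w u) {i j : ℕ} (hi : i + 1 + u.length < w.length)
    (hj : j + 1 + u.length < w.length) (hiu : ∀ k < u.length, w[i + 1 + k]? = u[k]?)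
    (hju : ∀ k < u.length, w[j + 1 + k]? = u[k]?) (hne : w[i]? ≠ w[j]?) :
    IsRightSpecial w u := by
  have h : ∀ k < u.length, w[i + 1 + k]? = w[j + 1 + k]? := fun k hk =>
    (hiu k hk).trans (hju k hk).symm
  have hw : (w.drop (i + 1)).take u.length = u := by
    ext1 k
    by_cases hk : k < u.length
    · simp [hk, hiu k hk]
    · simp [hk]
  by_cases hr : w[i + 1 + u.length]? = w[j + 1 + u.length]?
  · have hlong := isLeftSpecial_of_getElem? (n := u.length + 1) (i := i) (j := j) (by omega)
      (by omega) (fun k hk => by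
        rcases Nat.lt_succ_iff_lt_or_eq.1 hk with h' | rfl
        · exact h k h'
        · exact hr) hne
    have := hu.2 _ hlong
    simp at this
    omega
  · rw [← hw]
    exact Word.isRightSpecial_of_getElem? hi hj h hr

theorem exists_isLongestLeftSpecial {w v : List A} (hv : IsLeftSpecial w v) :
    ∃ u, IsLongestLeftSpecial w u := by
  classical
  let P : ℕ → Prop := fun n => ∃ u, IsLeftSpecial w u ∧ u.length = n
  have hbound : ∀ u, IsLeftSpecial w u → u.length ≤ w.length := by
    rintro u ⟨a, b, -, ha, -⟩
    have := ha.length_le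
    rw [List.length_cons] at this
    omega
  obtain ⟨u, hu, hlen⟩ : P (Nat.findGreatest P w.length) :=
    Nat.findGreatest_spec (hbound v hv) ⟨v, hv, rfl⟩
  exact ⟨u, hu, fun z hz => hlen ▸ Nat.le_findGreatest (hbound z hz) ⟨z, hz, rfl⟩⟩

variable [DecidableEq A]

theorem IsLongestLeftSpecial.isRightSpecial_of_lt (hA : Nat.card A = 2) {w u : List A}
    (hS : IsSturmian w) (hP : IsPalindrome w) (hu : IsLongestLeftSpecial w u) {i j : ℕ}
    (hij : i < j) (hj : j + 1 + u.length ≤ w.length)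
    (hiu : ∀ k < u.length, w[i + 1 + k]? = u[k]?)
    (hju : ∀ k < u.length, w[j + 1 + k]? = u[k]?) (hne : w[i]? ≠ w[j]?) :
    IsRightSpecial w u := by
  rcases hj.lt_or_eq with hlt | hsuff
  · exact hu.isRightSpecial_of_getElem? (by omega) hlt hiu hju hne
  have hL : ∀ v, IsLeftSpecial w v → v.length ≠ u.length + 1 := fun v hv => by
    have := hu.2 v hv
    omega
  have hR : ∀ v, IsRightSpecial w v → v.length ≠ u.length + 1 := fun v hv => by
    have := hu.2 _ (hP.isLeftSpecial_reverse_iff.2 hv)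
    rw [List.length_reverse] at this
    omega
  -- The later occurrence is a suffix of `w`. If `w` is long, a repeated factor of length `|u| + 1`
  -- forces a period `d + 1` on `w`, and the suffix occurrence can be shifted left by it.
  rcases Nat.lt_or_ge (2 * (u.length + 1)) w.length with hlong | hshort
  · obtain ⟨r, s, hrs, hs, hrep⟩ := hS.exists_repeated_factor hA hlong
    obtain ⟨d, rfl⟩ := Nat.exists_eq_add_of_lt hrs
    have hper := getElem?_add_of_repeated (i := r) (d := d + 1) (Nat.succ_pos _) hL hR (by omega)
      (take_drop_eq_iff.1 hrep)
    have hback : ∀ k, j + k < w.length → w[j - (d + 1) + k]? = w[j + k]? := by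
      intro k hk
      rw [hper _ (by omega), show j - (d + 1) + k + (d + 1) = j + k by omega]
    refine hu.isRightSpecial_of_getElem? (i := i) (j := j - (d + 1)) (by omega) (by omega) hiu
      (fun k hk => ?_) ?_
    · rw [← hju k hk, add_assoc, hback _ (by omega), add_assoc]
    · have := hback 0 (by omega)
      simp only [add_zero] at this
      rwa [this]
  · exfalso
    -- The mirror image of `j` is `|u|`. If `i < |u|` it lies in the first copy of `u`, and the
    -- matching place in the second copy mirrors `i`; otherwise `i = |u|` and `i`, `j` mirror each
    -- other.
    rcases Nat.lt_or_ge i u.length with hin | hin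
    · have h1 := hP.getElem?_eq (i := i) (j := w.length - 1 - i) (by omega)
      have h2 := hP.getElem?_eq (i := j) (j := w.length - 1 - j) (by omega)
      have h3 := (hiu (w.length - 1 - j - (i + 1)) (by omega)).trans
        (hju (w.length - 1 - j - (i + 1)) (by omega)).symm
      rw [show i + 1 + (w.length - 1 - j - (i + 1)) = w.length - 1 - j by omega,
        show j + 1 + (w.length - 1 - j - (i + 1)) = w.length - 1 - i by omega] at h3
      exact hne (h1.trans (h3.symm.trans h2.symm))
    · exact hne (hP.getElem?_eq (by omega))

theorem IsLongestLeftSpecial.isRightSpecial (hA : Nat.card A = 2) {w u : List A}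
    (hS : IsSturmian w) (hP : IsPalindrome w) (hu : IsLongestLeftSpecial w u) :
    IsRightSpecial w u := by
  have pos : ∀ c : A, (c :: u) <:+: w → ∃ i, i + 1 + u.length ≤ w.length ∧
      (∀ k < u.length, w[i + 1 + k]? = u[k]?) ∧ w[i]? = some c := by
    rintro c ⟨s, t, rfl⟩
    refine ⟨s.length, by simp; omega, fun k hk => ?_, by simp⟩
    rw [List.append_assoc, List.getElem?_append_right (by omega),
      show s.length + 1 + k - s.length = k + 1 by omega, List.cons_append,
      List.getElem?_cons_succ, List.getElem?_append_left hk]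
  obtain ⟨a, b, hab, ha, hb⟩ := hu.1
  obtain ⟨i, hi, hiu, hia⟩ := pos a ha
  obtain ⟨j, hj, hju, hjb⟩ := pos b hb
  have hne : w[i]? ≠ w[j]? := by
    rw [hia, hjb]
    simpa using hab
  rcases lt_trichotomy i j with h | rfl | h
  · exact hu.isRightSpecial_of_lt hA hS hP h hj hiu hju hne
  · exact absurd rfl hne
  · exact hu.isRightSpecial_of_lt hA hS hP h hi hju hiu hne.symm

theorem IsLongestLeftSpecial.isPalindrome (hA : Nat.card A = 2) {w u : List A}
    (hS : IsSturmian w) (hP : IsPalindrome w) (hu : IsLongestLeftSpecial w u) :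
    IsPalindrome u :=
  hS.eq_of_isLeftSpecial hA
    (hP.isLeftSpecial_reverse_iff.2 (hu.isRightSpecial hA hS hP)) hu.1 (by simp)

/-! ### Centrality -/

/-- Prefixing `a` or `b` to `u.take k` gives factors whose `b`-counts differ by one; balance against
both leaves two values. -/
theorem IsSturmian.count_infix_of_isLeftSpecial {w u v : List A} (hS : IsSturmian w) {a b : A}
    (hab : a ≠ b) (ha : (a :: u) <:+: w) (hb : (b :: u) <:+: w) {k : ℕ} (hk : k ≤ u.length)
    (hv : v <:+: w) (hvk : v.length = k + 1) :
    (u.take k).count b ≤ v.count b ∧ v.count b ≤ (u.take k).count b + 1 := by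
  have pre : ∀ c : A, (c :: u) <:+: w → (c :: u.take k) <:+: w := fun c hc => by
    rw [← List.take_succ_cons]
    exact (List.take_prefix _ _).isInfix.trans hc
  have h1 := hS v _ hv (pre a ha) (by simp [hvk, hk]) b
  have h2 := hS v _ hv (pre b hb) (by simp [hvk, hk]) b
  rw [List.count_cons_of_ne hab] at h1
  rw [List.count_cons_self] at h2
  rw [abs_le] at h1 h2
  push_cast at h2
  omega

theorem IsSturmian.isCentral_of_isLeftSpecial (hA : Nat.card A = 2) {w u : List A}
    (hS : IsSturmian w) (hu : IsLeftSpecial w u) (hPu : IsPalindrome u) : IsCentral u := by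
  obtain ⟨a, b, hab, ha, hb⟩ := hu
  have huw : u <:+: w := (List.suffix_cons a u).isInfix.trans ha
  -- Truncated subtraction gives `g 0 = 0`; the shift by one makes room for the extra letter in
  -- front of `u`.
  let g : ℕ → ℤ := fun s => ((u.take (s - 1)).count b : ℤ)
  have hg : ∀ s, g (s + 1) = (u.take s).count b := fun s => rfl
  have hsplit : ∀ i j, (u.take (i + j)).count b =
      (u.take i).count b + ((u.drop i).take j).count b := fun i j => by
    rw [List.take_add, List.count_append]
  have hstep : ∀ i (hi : i < u.length), g (i + 2) = g (i + 1) + if u[i] = b then 1 else 0 := by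
    intro i hi
    rw [hg, hg, List.take_succ_eq_append_getElem hi, List.count_append, List.count_singleton]
    simp only [beq_iff_eq]
    push_cast
    rfl
  -- Increments of `g` read off the letters of `u`, so a constant carry under translation by `p`
  -- means period `p`.
  have hletter : ∀ i p (hip : i + p < u.length),
      g (i + p + 2) - g (i + p + 1) = g (i + 2) - g (i + 1) → u[i]? = u[i + p]? := by
    intro i p hip h
    rw [hstep _ hip, hstep i (by omega)] at h
    rw [List.getElem?_eq_getElem hip, List.getElem?_eq_getElem (by omega : i < u.length)]
    congr 1
    rcases eq_or_eq_of_card_eq_two hA hab u[i] with h1 | h1 <;>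
      rcases eq_or_eq_of_card_eq_two hA hab u[i + p] with h2 | h2 <;>
      simp_all
  obtain ⟨p, q, hp, hq, hpq, hcop, hp', hq'⟩ := exists_coprime_carry (n := u.length + 2)
    (by omega) (h := (u.count b : ℤ) + 1) (g := g) (by simp [g])
    (by
      intro s t hs ht hst
      obtain ⟨s, rfl⟩ := Nat.exists_eq_add_of_le' hs
      obtain ⟨t, rfl⟩ := Nat.exists_eq_add_of_le' ht
      have h1 := hS.count_infix_of_isLeftSpecial hab ha hb (k := t) (by omega)
        ((take_drop_infix u s (t + 1)).trans huw) (by simp; omega)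
      have h2 := hsplit s (t + 1)
      rw [show s + 1 + (t + 1) = s + (t + 1) + 1 by omega, hg, hg, hg]
      omega)
    (by
      intro s t hs ht hst
      obtain ⟨s, rfl⟩ := Nat.exists_eq_add_of_le' hs
      obtain ⟨t, rfl⟩ := Nat.exists_eq_add_of_le' ht
      have h1 : (u.drop s).count b = (u.take t).count b := by
        rw [← List.count_reverse, List.reverse_drop, hPu, show u.length - s = t by omega]
      have h2 : u.count b = (u.take s).count b + (u.drop s).count b := by
        rw [← List.count_append, List.take_append_drop]
      rw [hg, hg]
      omega)
  refine ⟨p, q, ⟨hp, ?_⟩, ⟨hq, ?_⟩, hcop, hpq.symm⟩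
  · rw [List.hasPeriod_iff_getElem?]
    intro i hi
    refine hletter i p (by omega) ?_
    have h1 := hp' (i + 2) (by omega) (by omega)
    have h2 := hp' (i + 1) (by omega) (by omega)
    rw [show i + p + 2 = i + 2 + p by omega, show i + p + 1 = i + 1 + p by omega]
    omega
  · rw [List.hasPeriod_iff_getElem?]
    intro i hi
    refine hletter i q (by omega) ?_
    have h1 := hq' (i + 2) (by omega) (by omega)
    have h2 := hq' (i + 1) (by omega) (by omega)
    rw [show i + q + 2 = i + 2 + q by omega, show i + q + 1 = i + 1 + q by omega]
    omega

theorem isLongestLeftSpecial_iff_isLongestRightSpecial (hA : Nat.card A = 2) {w : List A}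
    (hS : IsSturmian w) (hP : IsPalindrome w) {u : List A} :
    IsLongestLeftSpecial w u ↔ IsLongestRightSpecial w u := by
  constructor
  · intro hu
    refine ⟨hu.isRightSpecial hA hS hP, fun v hv => ?_⟩
    simpa using hu.2 _ (hP.isLeftSpecial_reverse_iff.2 hv)
  · intro hu
    have hrev : IsLongestLeftSpecial w u.reverse := by
      refine ⟨hP.isLeftSpecial_reverse_iff.2 hu.1, fun v hv => ?_⟩
      simpa using hu.2 _ (hP.isRightSpecial_reverse_iff.2 hv)
    have := hrev.isPalindrome hA hS hP
    rw [IsPalindrome, List.reverse_reverse] at this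
    rwa [this]

end Word

/-- Let `w` be a Sturmian palindrome over a two-letter alphabet. If both letters occur in `w`, then
`w` has exactly one longest left special factor (if not, `w` is a power of a letter and has no
special factors at all). The longest left special factor of `w` is the same as the longest right
special factor of `w`, and it is a central word. -/
theorem corollary4p7 {A : Type*} [DecidableEq A] (hA : Nat.card A = 2) (w : List A)
    (hS : Word.IsSturmian w) (hP : Word.IsPalindrome w) :
    ((∀ c : A, c ∈ w) → ∃! u : List A, Word.IsLongestLeftSpecial w u) ∧
    (∀ u : List A, Word.IsLongestLeftSpecial w u ↔ Word.IsLongestRightSpecial w u) ∧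
    (∀ u : List A, Word.IsLongestLeftSpecial w u → Word.IsCentral u) := by
  refine ⟨fun hw => ?_, fun u => Word.isLongestLeftSpecial_iff_isLongestRightSpecial hA hS hP,
    fun u hu => hS.isCentral_of_isLeftSpecial hA hu.1 (hu.isPalindrome hA hS hP)⟩
  obtain ⟨a, b, hab, -⟩ := Nat.card_eq_two_iff.1 hA
  have hnil : Word.IsLeftSpecial w [] :=
    ⟨a, b, hab, (List.singleton_infix_iff _ _).2 (hw a), (List.singleton_infix_iff _ _).2 (hw b)⟩
  obtain ⟨u, hu⟩ := Word.exists_isLongestLeftSpecial hnil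
  exact ⟨u, hu, fun v hv => hS.eq_of_isLeftSpecial hA hv.1 hu.1
    (le_antisymm (hu.2 v hv.1) (hv.2 u hu.1))⟩
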